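/- Let $(H,\langle\cdot,\cdot\rangle)$ and $(\mathfrak h,[\cdot,\cdot])$ be complex Hilbert spaces, let $A:D(A)\subseteq H\to H$ be self-adjoint with resolvent set $\rho(A)$, and let $H_+$ be $D(A)$ with the scalar product $\langle\phi,\psi\rangle_+=\langle A\phi,A\psi\rangle+\langle\phi,\psi\rangle$. Let $\tau:H_+\to\mathfrak h$ be bounded, linear and surjective, with $N:=\operatorname{Ker}\tau$ dense in $H$, and let $A_N$ be the restriction of $A$ to $N$. For $z\in\rho(A)$ put $R(z):=(-A+z)^{-1}:H\to H_+$ and $G(z):=(\tau R(\bar z))^*:\mathfrak h\to H$, and put $G_*:=\tfrac12\,(G(i)+G(-i))$. For a densely defined closed symmetric operator $S$ on $H$ with equal defect indices, and linear maps $\gamma_1,\gamma_2:D(S^*)\to\mathfrak h$, the triple $\{\mathfrak h,\gamma_1,\gamma_2\}$ is called a boundary triple for $S^*$ if $\phi\mapsto(\gamma_1\phi,\gamma_2\phi)$ maps $D(S^*)$ onto $\mathfrak h\oplus\mathfrak h$ and $$\langle S^*\phi,\psi\rangle-\langle\phi,S^*\psi\rangle=[\gamma_1\phi,\gamma_2\psi]-[\gamma_2\phi,\gamma_1\psi]\qquad\text{for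 all }\phi,\psi\in D(S^*).$$ If $A$ is the restriction of $S^*$ to $\operatorname{Ker}\gamma_2$, the corresponding Weyl function of $S$ is the unique map $\Gamma:\rho(A)\to\mathsf B(\mathfrak h)$ with $\Gamma(z)\gamma_2\phi=\gamma_1\phi$ for all $z\in\rho(A)$ and all $\phi\in\operatorname{Ker}(-S^*+z)$. **Theorem 3.1.** (a) One has $$D(A_N^*)=\{\phi\in H:\ \phi=\phi_*+G_*\zeta_\phi,\ \phi_*\in D(A),\ \zeta_\phi\in\mathfrak h\},$$ where $\phi_*$ and $\zeta_\phi$ are uniquely determined by $\phi$, and $$A_N^*\phi=A\phi_*+R(i)\,G(-i)\,\zeta_\phi .$$ (b) The operator $A_N$ is densely defined, closed and symmetric, with equal defect indices. The maps $\gamma_1\phi:=-\tau\phi_*$ and $\gamma_2\phi:=\zeta_\phi$ on $D(A_N^*)$ are linear, and $\{\mathfrak h,\gamma_1,\gamma_2\}$ is a boundary triple for $A_N^*$. (c) The restriction of $A_N^*$ to $\operatorname{Ker}\gamma_2$ is $A$. For every $z\in\rho(A)$ the range of $G_*-G(z)$ lies in $D(A)$, and $\tau(G_*-G(z))$ is a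 bounded operator on $\mathfrak h$. The Weyl function of $A_N$ corresponding to $\{\mathfrak h,\gamma_1,\gamma_2\}$ exists and is $$\Gamma:\rho(A)\to\mathsf B(\mathfrak h),\qquad \Gamma(z)=\tau\,(G_*-G(z)).$$ -/

import Mathlib

namespace SingularPerturbation

variable {H : Type*} [NormedAddCommGroup H] [InnerProductSpace ℂ H]
variable {𝔥 : Type*} [NormedAddCommGroup 𝔥] [InnerProductSpace ℂ 𝔥]

/-! ### The space `H₊`: the domain of `A` with the graph scalar product -/

/-- The vector space `D(A)`, as a separate type that will carry the graph scalar product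
`⟨φ, ψ⟩₊ = ⟨A φ, A ψ⟩ + ⟨φ, ψ⟩` (and not the one induced by `H`). -/
def GraphSpace (A : H →ₗ.[ℂ] H) : Type _ := A.domain

namespace GraphSpace

variable (A : H →ₗ.[ℂ] H)

instance instAddCommGroup : AddCommGroup (GraphSpace A) :=
  inferInstanceAs (AddCommGroup A.domain)

instance instModule : Module ℂ (GraphSpace A) :=
  inferInstanceAs (Module ℂ A.domain)

/-- The identity map `D(A) → H₊`. -/
def ofDomain : A.domain ≃ₗ[ℂ] GraphSpace A := LinearEquiv.refl ℂ A.domain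

/-- The inclusion `H₊ → H`. -/
def incl : GraphSpace A →ₗ[ℂ] H :=
  A.domain.subtype ∘ₗ (ofDomain A).symm.toLinearMap

/-- The operator `A` as a linear map `H₊ → H`. -/
def op : GraphSpace A →ₗ[ℂ] H :=
  A.toFun ∘ₗ (ofDomain A).symm.toLinearMap

theorem incl_injective : Function.Injective (incl A) := fun _ _ h =>
  (ofDomain A).symm.injective (Subtype.ext h)

/-- The graph scalar product. -/
@[reducible] noncomputable def core : InnerProductSpace.Core ℂ (GraphSpace A) where
  inner φ ψ := inner ℂ (op A φ) (op A ψ) + inner ℂ (incl A φ) (incl A ψ)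
  conj_inner_symm φ ψ := by simp
  re_inner_nonneg φ := by
    have h1 := inner_self_nonneg (𝕜 := ℂ) (x := op A φ)
    have h2 := inner_self_nonneg (𝕜 := ℂ) (x := incl A φ)
    rw [map_add]
    exact add_nonneg h1 h2
  add_left φ ψ χ := by simp only [map_add, inner_add_left]; ring
  smul_left φ ψ r := by simp only [map_smul, inner_smul_left]; ring
  definite φ h := by
    have h1 := inner_self_nonneg (𝕜 := ℂ) (x := op A φ)
    have h2 := inner_self_nonneg (𝕜 := ℂ) (x := incl A φ)
    have h3 := congrArg RCLike.re h
    rw [map_add, map_zero] at h3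
    have h4 : RCLike.re (inner ℂ (incl A φ) (incl A φ)) = 0 := by linarith
    exact incl_injective A ((re_inner_self_nonpos.mp h4.le).trans (map_zero _).symm)

noncomputable instance instNormedAddCommGroup : NormedAddCommGroup (GraphSpace A) :=
  (core A).toNormedAddCommGroup

noncomputable instance instInnerProductSpace : InnerProductSpace ℂ (GraphSpace A) :=
  InnerProductSpace.ofCore (core A).toCore

theorem inner_def (φ ψ : GraphSpace A) :
    inner ℂ φ ψ = inner ℂ (op A φ) (op A ψ) + inner ℂ (incl A φ) (incl A ψ) := rfl

theorem norm_sq (φ : GraphSpace A) : ‖φ‖ ^ 2 = ‖op A φ‖ ^ 2 + ‖incl A φ‖ ^ 2 := by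
  have h := congrArg RCLike.re (inner_def A φ φ)
  rw [map_add] at h
  simpa only [inner_self_eq_norm_sq] using h

theorem norm_le (φ : GraphSpace A) : ‖φ‖ ≤ ‖op A φ‖ + ‖incl A φ‖ := by
  refine abs_le_of_sq_le_sq' ?_ (by positivity) |>.2
  rw [norm_sq]
  nlinarith [mul_nonneg (norm_nonneg (op A φ)) (norm_nonneg (incl A φ))]

end GraphSpace

/-! ### Resolvent set and resolvent of an unbounded operator -/

/-- `B` is the bounded, everywhere defined two-sided inverse of `-A + z : D(A) → H`. -/
def IsInverseAt (A : H →ₗ.[ℂ] H) (z : ℂ) (B : H →L[ℂ] H) : Prop :=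
  (∀ x : H, ∃ hx : B x ∈ A.domain, -A ⟨B x, hx⟩ + z • B x = x) ∧
    ∀ φ : A.domain, B (-A φ + z • (φ : H)) = φ

/-- The resolvent set `ρ(A)`. -/
def resolvSet (A : H →ₗ.[ℂ] H) : Set ℂ := {z | ∃ B : H →L[ℂ] H, IsInverseAt A z B}

/-- A bounded inverse of `-A + z`, regarded as a bounded map from `H` to `H₊`. -/
noncomputable def IsInverseAt.toGraphSpace {A : H →ₗ.[ℂ] H} {z : ℂ} {B : H →L[ℂ] H}
    (h : IsInverseAt A z B) : H →L[ℂ] GraphSpace A :=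
  LinearMap.mkContinuous
    ((GraphSpace.ofDomain A).toLinearMap ∘ₗ
      B.toLinearMap.codRestrict A.domain fun x => (h.1 x).1)
    ((‖z‖ * ‖B‖ + 1) + ‖B‖) (by
      intro x
      refine (GraphSpace.norm_le A _).trans ?_
      obtain ⟨hx, hAx⟩ := h.1 x
      change ‖A ⟨B x, hx⟩‖ + ‖B x‖ ≤ _
      have hA : A ⟨B x, hx⟩ = z • B x - x := by
        rw [eq_sub_iff_add_eq, ← eq_sub_iff_add_eq']
        nth_rewrite 1 [← hAx]
        abel
      have h1 : ‖A ⟨B x, hx⟩‖ ≤ ‖z‖ * (‖B‖ * ‖x‖) + ‖x‖ := by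
        rw [hA]
        refine (norm_sub_le _ _).trans ?_
        rw [norm_smul]
        gcongr
        exact B.le_opNorm x
      have h2 := B.le_opNorm x
      nlinarith)

open scoped Classical in
/-- The resolvent `R(z) = (-A + z)⁻¹ : H → H₊` for `z ∈ ρ(A)` (and `0` for other `z`). -/
noncomputable def R (A : H →ₗ.[ℂ] H) (z : ℂ) : H →L[ℂ] GraphSpace A :=
  if h : z ∈ resolvSet A then h.choose_spec.toGraphSpace else 0

/-! ### The operators `G(z)`, `G_*` and the restriction `A_N` -/

section G

variable [CompleteSpace H] [CompleteSpace 𝔥]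

/-- `G(z) = (τ R(z̄))^* : 𝔥 → H`. -/
noncomputable def G (A : H →ₗ.[ℂ] H) (τ : GraphSpace A →L[ℂ] 𝔥) (z : ℂ) : 𝔥 →L[ℂ] H :=
  ContinuousLinearMap.adjoint (τ ∘L R A (starRingEnd ℂ z))

/-- `G_* = (G(i) + G(-i)) / 2`. -/
noncomputable def Gstar (A : H →ₗ.[ℂ] H) (τ : GraphSpace A →L[ℂ] 𝔥) : 𝔥 →L[ℂ] H :=
  (1 / 2 : ℂ) • (G A τ Complex.I + G A τ (-Complex.I))

end G

/-- `N = Ker τ`, as a subspace of `H`. -/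
def kerSubspace (A : H →ₗ.[ℂ] H) (τ : GraphSpace A →L[ℂ] 𝔥) : Submodule ℂ H :=
  (LinearMap.ker τ.toLinearMap).map (GraphSpace.incl A)

/-- `A_N`: the restriction of `A` to `N = Ker τ`. -/
def restrictKer (A : H →ₗ.[ℂ] H) (τ : GraphSpace A →L[ℂ] 𝔥) : H →ₗ.[ℂ] H :=
  A.domRestrict (kerSubspace A τ)

/-! ### Boundary triples and Weyl functions -/

section BoundaryTriple

variable [CompleteSpace H]

/-- `K_z = Ker(-S^* + z)`, as a subspace of `H`. -/
noncomputable def defectSpace (S : H →ₗ.[ℂ] H) (z : ℂ) : Submodule ℂ H :=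
  (LinearMap.ker (-S.adjoint.toFun + z • S.adjoint.domain.subtype)).map S.adjoint.domain.subtype

/-- The operators for whose adjoints boundary triples are considered: densely defined closed
symmetric operators with equal defect indices. The defect indices are the Hilbert space dimensions
of the closed subspaces `K_i` and `K_{-i}`, so that they are equal iff these are isometric. -/
structure IsClosedSymmetricEqualDefect (S : H →ₗ.[ℂ] H) : Prop where
  dense : Dense (S.domain : Set H)
  closed : S.IsClosed
  symmetric : S.IsFormalAdjoint S
  equal_defect :
    Nonempty (defectSpace S Complex.I ≃ₗᵢ[ℂ] defectSpace S (-Complex.I))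

/-- `{𝔥, γ₁, γ₂}` is a boundary triple for `S^*`. -/
structure IsBoundaryTriple (S : H →ₗ.[ℂ] H) (γ₁ γ₂ : S.adjoint.domain →ₗ[ℂ] 𝔥) : Prop
    extends IsClosedSymmetricEqualDefect S where
  surjective : Function.Surjective fun φ : S.adjoint.domain => (γ₁ φ, γ₂ φ)
  green : ∀ φ ψ : S.adjoint.domain,
    inner ℂ (S.adjoint φ) (ψ : H) - inner ℂ (φ : H) (S.adjoint ψ) =
      inner ℂ (γ₁ φ) (γ₂ ψ) - inner ℂ (γ₂ φ) (γ₁ ψ)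

/-- `Γ(z) γ₂ φ = γ₁ φ` for all `z ∈ ρ(A)` and all `φ ∈ K_z`. -/
def WeylRelation (S A : H →ₗ.[ℂ] H) (γ₁ γ₂ : S.adjoint.domain →ₗ[ℂ] 𝔥)
    (Γ : resolvSet A → (𝔥 →L[ℂ] 𝔥)) : Prop :=
  ∀ (z : resolvSet A) (φ : S.adjoint.domain), (φ : H) ∈ defectSpace S z → Γ z (γ₂ φ) = γ₁ φ

/-- `Γ : ρ(A) → B(𝔥)` is the Weyl function of `S` corresponding to `{𝔥, γ₁, γ₂}`: `A` is the
extension of `S` obtained by restricting `S^*` to `γ₂ φ = 0`, and `Γ` is the unique map such that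
`Γ(z) γ₂ φ = γ₁ φ` on every `K_z`. -/
structure IsWeylFunction (S A : H →ₗ.[ℂ] H) (γ₁ γ₂ : S.adjoint.domain →ₗ[ℂ] 𝔥)
    (Γ : resolvSet A → (𝔥 →L[ℂ] 𝔥)) : Prop where
  extension_eq :
    S.adjoint.domRestrict ((LinearMap.ker γ₂).map S.adjoint.domain.subtype) = A
  relation : WeylRelation S A γ₁ γ₂ Γ
  unique : ∀ Γ' : resolvSet A → (𝔥 →L[ℂ] 𝔥), WeylRelation S A γ₁ γ₂ Γ' → Γ' = Γ

end BoundaryTriple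

end SingularPerturbation

open SingularPerturbation

namespace SingularPerturbation

open Complex GraphSpace

variable {H : Type*} [NormedAddCommGroup H] [InnerProductSpace ℂ H]

/-! ### Resolvent identities, with values in `GraphSpace A` -/

section Resolvent

variable {A : H →ₗ.[ℂ] H} {z : ℂ}

/-! Testing G(z)ζ against (z̄ - A)f gives the weak equation ⟨G(z)ζ, Af⟩ = ⟨zG(z)ζ, f⟩ - [ζ, τf]
(`inner_G_op`). On Ker τ the last term drops out, so G(z)ζ lies in the defect space K_z = Ker(-A_N^*
+ z). Conversely, K_z is orthogonal to Ker(τR(z̄)), and since τR(z̄) is onto, this orthogonal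
complement is the range of its adjoint G(z) (`mem_defectSpace_restrictKer_iff`).

The adjoint of the resolvent identity, G(w) - G(z) = (z - w)R(z)G(w), puts all these differences in
D(A). Hence D(A_N^*) = D(A) + K_i = D(A) + Ran G_*, and averaging the weak equations at ±i gives
A_N^* G_* = (i/2)(G(i) - G(-i)) = R(i)G(-i).

In Green's formula the mixed terms are the boundary terms of the averaged weak equation. The terms
quadratic in ζ cancel, because G(i) is G(-i) followed by the Cayley transform, an isometry; this is
why G_* is the symmetric average. The Weyl function is read off from G(z)ζ = -(G_* - G(z))ζ + G_*ζ.
-/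

theorem GraphSpace.exists_incl_eq (φ : A.domain) :
    ∃ f : GraphSpace A, incl A f = φ ∧ op A f = A φ ∧ f = ofDomain A φ :=
  ⟨ofDomain A φ, rfl, rfl, rfl⟩

theorem GraphSpace.incl_mem (f : GraphSpace A) : incl A f ∈ A.domain :=
  ((ofDomain A).symm f).2

theorem GraphSpace.apply_incl (f : GraphSpace A) (h : incl A f ∈ A.domain) :
    A ⟨incl A f, h⟩ = op A f := rfl

theorem GraphSpace.mem_graph_iff_exists {x y : H} :
    (x, y) ∈ A.graph ↔ ∃ f : GraphSpace A, incl A f = x ∧ op A f = y :=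
  A.mem_graph_iff

theorem op_R (hz : z ∈ resolvSet A) (x : H) :
    op A (R A z x) = z • incl A (R A z x) - x := by
  unfold R
  rw [dif_pos hz]
  obtain ⟨h, e⟩ := hz.choose_spec.1 x
  change A ⟨hz.choose x, h⟩ = z • hz.choose x - x
  nth_rewrite 3 [← e]
  abel

theorem R_smul_sub_op (hz : z ∈ resolvSet A) (f : GraphSpace A) :
    R A z (z • incl A f - op A f) = f := by
  unfold R
  rw [dif_pos hz]
  apply incl_injective A
  have e := hz.choose_spec.2 ((ofDomain A).symm f)
  rw [neg_add_eq_sub] at e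
  exact e

theorem R_surjective (hz : z ∈ resolvSet A) : Function.Surjective (R A z) :=
  fun f => ⟨_, R_smul_sub_op hz f⟩

/-- Apply R(w)(-A + w) = 1 to R(z)x, using (-A + w)R(z)x = (w - z)R(z)x + x. -/
theorem R_sub_R {w : ℂ} (hz : z ∈ resolvSet A) (hw : w ∈ resolvSet A) (x : H) :
    R A w x - R A z x = (z - w) • R A w (incl A (R A z x)) := by
  have h := R_smul_sub_op hw (R A z x)
  rw [op_R hz, sub_sub_eq_add_sub, add_comm, add_sub_assoc, ← sub_smul, map_add, map_smul] at h
  rw [sub_eq_iff_eq_add', ← neg_sub w z, neg_smul, ← sub_eq_add_neg, eq_sub_iff_add_eq]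
  exact h

end Resolvent

/-! ### Self-adjointness: non-real points of ρ(A), and R(z)^* = R(z̄) -/

section SelfAdjoint

variable [CompleteSpace H] {A : H →ₗ.[ℂ] H} {z : ℂ}

theorem inner_op_left (hA : IsSelfAdjoint A) (f g : GraphSpace A) :
    inner ℂ (op A f) (incl A g) = inner ℂ (incl A f) (op A g) := by
  have h := LinearPMap.adjoint_isFormalAdjoint hA.dense_domain
  rw [LinearPMap.isSelfAdjoint_def.1 hA] at h
  exact h _ _

/-- A weak solution of Ax = y is a strong one, because A^* has no larger domain than A. -/
theorem exists_incl_eq_of_inner (hA : IsSelfAdjoint A) {x y : H}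
    (h : ∀ g : GraphSpace A, inner ℂ y (incl A g) = inner ℂ x (op A g)) :
    ∃ f : GraphSpace A, incl A f = x ∧ op A f = y := by
  have hx : x ∈ A.adjoint.domain := LinearPMap.mem_adjoint_domain_of_exists x ⟨y, h⟩
  have hg : (x, y) ∈ A.adjoint.graph := A.adjoint.mem_graph_iff.2
    ⟨⟨x, hx⟩, rfl, LinearPMap.adjoint_apply_eq hA.dense_domain _ h⟩
  rwa [LinearPMap.isSelfAdjoint_def.1 hA, mem_graph_iff_exists] at hg

theorem isClosed_graph (hA : IsSelfAdjoint A) : A.IsClosed := by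
  have h := LinearPMap.adjoint_isClosed hA.dense_domain
  rwa [LinearPMap.isSelfAdjoint_def.1 hA] at h

/-- Since ⟨f, Af⟩ is real, Im⟨f, (z - A)f⟩ = Im z · ‖f‖²; then Cauchy–Schwarz. -/
theorem abs_im_mul_norm_le (hA : IsSelfAdjoint A) (z : ℂ) (f : GraphSpace A) :
    |z.im| * ‖incl A f‖ ≤ ‖z • incl A f - op A f‖ := by
  rcases eq_or_ne (incl A f) 0 with h0 | h0
  · simp [h0]
  have hreal : (inner ℂ (incl A f) (op A f) : ℂ).im = 0 := by
    rw [← conj_eq_iff_im, inner_conj_symm]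
    exact inner_op_left hA f f
  have him : (inner ℂ (incl A f) (z • incl A f - op A f) : ℂ).im = z.im * ‖incl A f‖ ^ 2 := by
    rw [inner_sub_right, inner_smul_right, inner_self_eq_norm_sq_to_K, sub_im, hreal, sub_zero]
    norm_cast
    simp only [coe_algebraMap, im_mul_ofReal]
  have hle : |z.im| * ‖incl A f‖ ^ 2 ≤ ‖incl A f‖ * ‖z • incl A f - op A f‖ := by
    rw [← abs_of_nonneg (sq_nonneg ‖incl A f‖), ← abs_mul, ← him]
    exact (abs_im_le_norm _).trans (norm_inner_le_norm _ _)
  have hpos : 0 < ‖incl A f‖ := norm_pos_iff.2 h0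
  refine le_of_mul_le_mul_left ?_ hpos
  linarith

/-- The lower bound for z - A gives injectivity, closed range (as A is closed) and a bounded
inverse. The range is dense because its orthogonal complement is Ker(A - z̄), which vanishes by the
same bound at z̄. -/
theorem mem_resolvSet_of_im_ne_zero (hA : IsSelfAdjoint A) (hz : z.im ≠ 0) :
    z ∈ resolvSet A := by
  have inj_of (w : ℂ) (hw : w.im ≠ 0) (f : GraphSpace A) (h : w • incl A f - op A f = 0) :
      f = 0 := by
    have := abs_im_mul_norm_le hA w f
    rw [h, norm_zero] at this
    have h0 : ‖incl A f‖ = 0 := by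
      have := abs_pos.2 hw
      nlinarith [norm_nonneg (incl A f)]
    exact incl_injective A ((norm_eq_zero.1 h0).trans (map_zero _).symm)
  let T : GraphSpace A →ₗ[ℂ] H := z • incl A - op A
  have hT (f) : T f = z • incl A f - op A f := rfl
  have hinj : Function.Injective T := (injective_iff_map_eq_zero T).2 fun f hf => inj_of z hz f hf
  have hclosed : IsClosed (LinearMap.range T : Set H) := by
    refine isClosed_of_closure_subset fun y hy => ?_
    obtain ⟨u, hu, hlim⟩ := mem_closure_iff_seq_limit.1 hy
    choose f hf using hu
    have hc : CauchySeq fun n => incl A (f n) := by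
      refine Metric.cauchySeq_iff.2 fun ε hε => ?_
      obtain ⟨N, hN⟩ := Metric.cauchySeq_iff.1 hlim.cauchySeq (|z.im| * ε)
        (mul_pos (abs_pos.2 hz) hε)
      refine ⟨N, fun m hm n hn => ?_⟩
      have h1 := hN m hm n hn
      rw [dist_eq_norm, ← hf, ← hf, ← map_sub] at h1
      have h2 := (abs_im_mul_norm_le hA z (f m - f n)).trans_lt h1
      rw [dist_eq_norm, ← map_sub]
      exact lt_of_mul_lt_mul_left h2 (abs_nonneg _)
    obtain ⟨x, hx⟩ := cauchySeq_tendsto_of_complete hc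
    have hop : Filter.Tendsto (fun n => op A (f n)) Filter.atTop (nhds (z • x - y)) := by
      refine ((hx.const_smul z).sub hlim).congr fun n => ?_
      rw [← hf, hT, sub_sub_cancel]
    have hmem := (isClosed_graph hA).mem_of_tendsto (hx.prodMk_nhds hop)
      (Filter.Eventually.of_forall fun n => mem_graph_iff_exists.2 ⟨f n, rfl, rfl⟩)
    obtain ⟨g, hg, hg'⟩ := mem_graph_iff_exists.1 hmem
    exact ⟨g, by rw [hT, hg, hg', sub_sub_cancel]⟩
  have hsurj : Function.Surjective T := by
    rw [← LinearMap.range_eq_top, ← hclosed.submodule_topologicalClosure_eq,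
      Submodule.topologicalClosure_eq_top_iff, Submodule.eq_bot_iff]
    intro x hx
    rw [Submodule.mem_orthogonal'] at hx
    obtain ⟨f, rfl, hf⟩ := exists_incl_eq_of_inner hA (x := x) (y := (starRingEnd ℂ z) • x)
      fun g => by
        have := hx _ ⟨g, rfl⟩
        rw [hT, inner_sub_right, inner_smul_right, sub_eq_zero] at this
        rw [inner_smul_left, conj_conj, this]
    rw [inj_of (starRingEnd ℂ z) (by simpa using hz) f (by rw [hf, sub_self]), map_zero]
  let e := LinearEquiv.ofBijective T ⟨hinj, hsurj⟩
  have he (x) : z • incl A (e.symm x) - op A (e.symm x) = x := e.apply_symm_apply x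
  let B : H →L[ℂ] H := LinearMap.mkContinuous (incl A ∘ₗ e.symm.toLinearMap) |z.im|⁻¹ fun x => by
    have := abs_im_mul_norm_le hA z (e.symm x)
    rw [he] at this
    rw [inv_mul_eq_div, le_div_iff₀' (abs_pos.2 hz)]
    exact this
  refine ⟨B, fun x => ⟨incl_mem (e.symm x), ?_⟩, fun φ => ?_⟩
  · rw [neg_add_eq_sub]
    exact he x
  · rw [neg_add_eq_sub]
    exact congrArg (incl A) (e.symm_apply_apply (ofDomain A φ))

theorem I_mem_resolvSet (hA : IsSelfAdjoint A) : I ∈ resolvSet A :=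
  mem_resolvSet_of_im_ne_zero hA (by simp)

theorem neg_I_mem_resolvSet (hA : IsSelfAdjoint A) : -I ∈ resolvSet A :=
  mem_resolvSet_of_im_ne_zero hA (by simp)

theorem conj_mem_resolvSet (hA : IsSelfAdjoint A) (hz : z ∈ resolvSet A) :
    starRingEnd ℂ z ∈ resolvSet A := by
  obtain ⟨B, hB, hB'⟩ := hz
  -- B^* is the inverse at z̄: taking the adjoint of B(-A + z) = 1 gives A B^*x = z̄B^*x - x weakly,
  -- hence strongly.
  have key (x : H) : ∃ f : GraphSpace A, incl A f = B.adjoint x ∧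
      op A f = starRingEnd ℂ z • B.adjoint x - x :=
    exists_incl_eq_of_inner hA fun g => by
      have h := hB' ((ofDomain A).symm g)
      change B (-op A g + z • incl A g) = incl A g at h
      rw [inner_sub_left, inner_smul_left, conj_conj, B.adjoint_inner_left, B.adjoint_inner_left]
      nth_rewrite 2 [← h]
      rw [map_add, map_neg, map_smul, inner_add_right, inner_neg_right, inner_smul_right]
      ring
  refine ⟨B.adjoint, fun x => ?_, fun φ => ?_⟩
  · obtain ⟨f, hf, hf'⟩ := key x
    have hd : B.adjoint x ∈ A.domain := hf ▸ incl_mem f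
    have hAf : A ⟨B.adjoint x, hd⟩ = op A f := by
      rw [← apply_incl f (incl_mem f)]
      congr 1
      exact Subtype.ext hf.symm
    exact ⟨hd, by rw [hAf, hf']; abel⟩
  · obtain ⟨f, hf, hf', -⟩ := exists_incl_eq φ
    refine ext_inner_right ℂ fun y => ?_
    obtain ⟨hd, hy⟩ := hB y
    rw [B.adjoint_inner_left, ← hf, ← hf']
    have := inner_op_left hA f (ofDomain A ⟨B y, hd⟩)
    change inner ℂ (op A f) (B y) = inner ℂ (incl A f) (A ⟨B y, hd⟩) at this
    rw [inner_add_left, inner_neg_left, inner_smul_left, conj_conj, this]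
    rw [← inner_neg_right, ← inner_smul_right, ← inner_add_right, hy]

theorem inner_incl_R_left (hA : IsSelfAdjoint A) (hz : z ∈ resolvSet A) (x y : H) :
    inner ℂ (incl A (R A z x)) y = inner ℂ x (incl A (R A (starRingEnd ℂ z) y)) := by
  have h := inner_op_left hA (R A z x) (R A (starRingEnd ℂ z) y)
  rw [op_R hz, op_R (conj_mem_resolvSet hA hz), inner_sub_left, inner_sub_right, inner_smul_left,
    inner_smul_right] at h
  exact (sub_right_injective h).symm

end SelfAdjoint

/-! ### Range of the adjoint of a surjection -/

/-- A bounded right inverse S of L exists: invert L on (Ker L)^⊥. As SLy - y ∈ Ker L, a vector x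
orthogonal to Ker L satisfies x = L^*S^*x. -/
theorem exists_adjoint_eq_of_surjective {E F : Type*} [NormedAddCommGroup E]
    [InnerProductSpace ℂ E] [CompleteSpace E] [NormedAddCommGroup F] [InnerProductSpace ℂ F]
    [CompleteSpace F] (L : E →L[ℂ] F) (hL : Function.Surjective L) {x : E}
    (hx : ∀ y, L y = 0 → inner ℂ x y = 0) : ∃ ζ : F, L.adjoint ζ = x := by
  obtain ⟨S, hS⟩ : ∃ S : F →L[ℂ] E, ∀ y, L (S y) = y := by
    let K := (LinearMap.ker L.toLinearMap)ᗮ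
    have hK : IsClosed (LinearMap.ker L.toLinearMap : Set E) := L.isClosed_ker
    have := hK.completeSpace_coe
    have hinj : LinearMap.ker (L ∘L K.subtypeL).toLinearMap = ⊥ := by
      refine LinearMap.ker_eq_bot'.2 fun u hu => Subtype.ext ?_
      exact inner_self_eq_zero.1 ((Submodule.mem_orthogonal _ _).1 u.2 u hu)
    have hsurj : LinearMap.range (L ∘L K.subtypeL).toLinearMap = ⊤ := by
      refine LinearMap.range_eq_top.2 fun y => ?_
      obtain ⟨x, rfl⟩ := hL y
      obtain ⟨u, hu, v, hv, rfl⟩ :=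
        Submodule.exists_add_mem_mem_orthogonal (K := LinearMap.ker L.toLinearMap) x
      refine ⟨⟨v, hv⟩, ?_⟩
      have hu' : L u = 0 := hu
      rw [map_add, hu', zero_add]
      rfl
    let e := ContinuousLinearEquiv.ofBijective (L ∘L K.subtypeL) hinj hsurj
    exact ⟨K.subtypeL ∘L e.symm.toContinuousLinearMap,
      ContinuousLinearEquiv.ofBijective_apply_symm_apply _ hinj hsurj⟩
  refine ⟨S.adjoint x, ext_inner_right ℂ fun y => ?_⟩
  rw [L.adjoint_inner_left, S.adjoint_inner_left, ← sub_eq_zero, ← inner_sub_right]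
  exact hx _ (by rw [map_sub, hS, sub_self])

end SingularPerturbation

namespace SingularPerturbation

open Complex GraphSpace

variable {H : Type*} [NormedAddCommGroup H] [InnerProductSpace ℂ H]
variable {𝔥 : Type*} [NormedAddCommGroup 𝔥] [InnerProductSpace ℂ 𝔥]

/-! ### Graphs of A_N and of its adjoint -/

section Restriction

variable {A : H →ₗ.[ℂ] H} {τ : GraphSpace A →L[ℂ] 𝔥}

theorem mem_graph_restrictKer_iff {x y : H} :
    (x, y) ∈ (restrictKer A τ).graph ↔
      ∃ f : GraphSpace A, τ f = 0 ∧ incl A f = x ∧ op A f = y := by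
  rw [LinearPMap.mem_graph_iff]
  constructor
  · rintro ⟨⟨_, ⟨f, hf, rfl⟩, h⟩, rfl, rfl⟩
    exact ⟨f, hf, rfl, rfl⟩
  · rintro ⟨f, hf, rfl, rfl⟩
    exact ⟨⟨incl A f, ⟨f, hf, rfl⟩, incl_mem f⟩, rfl, rfl⟩

theorem exists_mem_restrictKer_domain (f : GraphSpace A) (hf : τ f = 0) :
    ∃ n : (restrictKer A τ).domain, (n : H) = incl A f ∧ restrictKer A τ n = op A f :=
  LinearPMap.mem_graph_iff _ |>.1 (mem_graph_restrictKer_iff.2 ⟨f, hf, rfl, rfl⟩)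

theorem exists_incl_eq_restrictKer (n : (restrictKer A τ).domain) :
    ∃ f : GraphSpace A, τ f = 0 ∧ incl A f = n ∧ op A f = restrictKer A τ n :=
  mem_graph_restrictKer_iff.1 (LinearPMap.mem_graph _ n)

theorem restrictKer_dense (hN : Dense (kerSubspace A τ : Set H)) :
    Dense ((restrictKer A τ).domain : Set H) :=
  hN.mono fun x hx => ⟨hx, by obtain ⟨f, -, rfl⟩ := hx; exact incl_mem f⟩

theorem mem_graph_adjoint_restrictKer_iff [CompleteSpace H]
    (hN : Dense (kerSubspace A τ : Set H)) {x y : H} :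
    (x, y) ∈ (restrictKer A τ).adjoint.graph ↔
      ∀ f : GraphSpace A, τ f = 0 → inner ℂ y (incl A f) = inner ℂ x (op A f) := by
  rw [LinearPMap.mem_graph_iff]
  constructor
  · rintro ⟨u, rfl, rfl⟩ f hf
    obtain ⟨n, hn, hn'⟩ := exists_mem_restrictKer_domain f hf
    rw [← hn, ← hn']
    exact LinearPMap.adjoint_isFormalAdjoint (restrictKer_dense hN) u n
  · intro h
    have h' : ∀ n : (restrictKer A τ).domain, inner ℂ y (n : H) = inner ℂ x (restrictKer A τ n) := by
      intro n
      obtain ⟨f, hf, hf', hf''⟩ := exists_incl_eq_restrictKer n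
      rw [← hf', ← hf'']
      exact h f hf
    exact ⟨⟨x, LinearPMap.mem_adjoint_domain_of_exists x ⟨y, h'⟩⟩, rfl,
      LinearPMap.adjoint_apply_eq (restrictKer_dense hN) _ h'⟩

theorem mem_defectSpace_iff [CompleteSpace H] {S : H →ₗ.[ℂ] H} {z : ℂ} {x : H} :
    x ∈ defectSpace S z ↔ (x, z • x) ∈ S.adjoint.graph := by
  rw [LinearPMap.mem_graph_iff]
  have key (u : S.adjoint.domain) :
      u ∈ LinearMap.ker (-S.adjoint.toFun + z • S.adjoint.domain.subtype) ↔
        S.adjoint u = z • (u : H) := by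
    change -S.adjoint u + z • (u : H) = 0 ↔ _
    rw [neg_add_eq_zero]
  constructor
  · rintro ⟨u, hu, rfl⟩
    exact ⟨u, rfl, (key u).1 hu⟩
  · rintro ⟨u, rfl, hu⟩
    exact ⟨u, (key u).2 hu, rfl⟩

end Restriction

/-! ### Cayley transform; A_N is closed with equal defect indices -/

section Cayley

/-- 1 - (z - w)R(z) is (w - A)(z - A)⁻¹, so exchanging z and w inverts it. -/
theorem cayley_cayley {A : H →ₗ.[ℂ] H} {z w : ℂ} (hz : z ∈ resolvSet A) (hw : w ∈ resolvSet A)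
    (x : H) :
    x - (z - w) • incl A (R A z x) -
      (w - z) • incl A (R A w (x - (z - w) • incl A (R A z x))) = x := by
  have h := congrArg (incl A) (R_sub_R hz hw x)
  simp only [map_sub, map_smul] at h ⊢
  rw [← h]
  module

variable [CompleteSpace H] {A : H →ₗ.[ℂ] H} {z : ℂ}

/-- With u = R(z)x the transform sends (z - A)u to (z̄ - A)u; symmetry of A makes the scalar
products agree. -/
theorem inner_cayley (hA : IsSelfAdjoint A) (hz : z ∈ resolvSet A) (x y : H) :
    inner ℂ (x - (z - starRingEnd ℂ z) • incl A (R A z x))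
      (y - (z - starRingEnd ℂ z) • incl A (R A z y)) = inner ℂ x y := by
  have hop (x : H) : x = z • incl A (R A z x) - op A (R A z x) := by
    rw [op_R hz, sub_sub_cancel]
  have hU (x : H) : x - (z - starRingEnd ℂ z) • incl A (R A z x) =
      starRingEnd ℂ z • incl A (R A z x) - op A (R A z x) := by
    rw [op_R hz, sub_smul]
    abel
  rw [hU, hU]
  conv_rhs => rw [hop x, hop y]
  simp only [inner_sub_left, inner_sub_right, inner_smul_left, inner_smul_right, conj_conj,
    inner_op_left hA]
  ring

theorem isClosed_restrictKer {τ : GraphSpace A →L[ℂ] 𝔥} (hA : IsSelfAdjoint A) :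
    (restrictKer A τ).IsClosed := by
  have hI := I_mem_resolvSet hA
  -- On the graph of A, τf = τR(i)(if - Af), and the right side is continuous on all of H × H.
  have h : ((restrictKer A τ).graph : Set (H × H)) =
      (A.graph : Set (H × H)) ∩ {p : H × H | τ (R A I (I • p.1 - p.2)) = 0} := by
    ext ⟨x, y⟩
    constructor
    · intro h
      obtain ⟨f, hf, rfl, rfl⟩ := mem_graph_restrictKer_iff.1 h
      exact ⟨mem_graph_iff_exists.2 ⟨f, rfl, rfl⟩, by
        rw [Set.mem_ofPred_eq, R_smul_sub_op hI, hf]⟩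
    · rintro ⟨h, h'⟩
      obtain ⟨f, rfl, rfl⟩ := mem_graph_iff_exists.1 h
      rw [Set.mem_ofPred_eq, R_smul_sub_op hI] at h'
      exact mem_graph_restrictKer_iff.2 ⟨f, h', rfl, rfl⟩
  rw [LinearPMap.IsClosed, h]
  exact IsClosed.inter (isClosed_graph hA) (isClosed_eq (by fun_prop) continuous_const)

theorem mem_graph_adjoint_of_incl {τ : GraphSpace A →L[ℂ] 𝔥} (hA : IsSelfAdjoint A)
    (hN : Dense (kerSubspace A τ : Set H)) (f : GraphSpace A) :
    (incl A f, op A f) ∈ (restrictKer A τ).adjoint.graph :=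
  (mem_graph_adjoint_restrictKer_iff hN).2 fun g _ => inner_op_left hA f g

/-- A_N^* sends x to z̄x and R(z)x to zR(z)x - x; in this combination the two add up to the factor
z. -/
theorem cayley_mem_defectSpace {τ : GraphSpace A →L[ℂ] 𝔥} (hA : IsSelfAdjoint A)
    (hN : Dense (kerSubspace A τ : Set H)) (hz : z ∈ resolvSet A) {x : H}
    (hx : x ∈ defectSpace (restrictKer A τ) (starRingEnd ℂ z)) :
    x - (z - starRingEnd ℂ z) • incl A (R A z x) ∈ defectSpace (restrictKer A τ) z := by
  rw [mem_defectSpace_iff] at hx ⊢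
  have h := sub_mem hx (Submodule.smul_mem _ (z - starRingEnd ℂ z)
    (mem_graph_adjoint_of_incl hA hN (R A z x)))
  convert h using 1
  rw [Prod.smul_mk, Prod.mk_sub_mk, op_R hz]
  congr 1
  module

/-- The Cayley transform restricts to an isometry between the defect spaces at `z̄` and `z`. -/
noncomputable def defectEquiv {τ : GraphSpace A →L[ℂ] 𝔥} (hA : IsSelfAdjoint A)
    (hN : Dense (kerSubspace A τ : Set H)) (hz : z ∈ resolvSet A) :
    defectSpace (restrictKer A τ) (starRingEnd ℂ z) ≃ₗᵢ[ℂ] defectSpace (restrictKer A τ) z where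
  toFun x := ⟨_, cayley_mem_defectSpace hA hN hz x.2⟩
  invFun x := ⟨x - (starRingEnd ℂ z - z) • incl A (R A (starRingEnd ℂ z) x), by
    have h := cayley_mem_defectSpace hA hN (conj_mem_resolvSet hA hz) (x := (x : H))
      (by rw [conj_conj]; exact x.2)
    rwa [conj_conj] at h⟩
  map_add' x y := Subtype.ext (by simp only [Submodule.coe_add, map_add]; module)
  map_smul' c x := Subtype.ext (by
    simp only [Submodule.coe_smul, map_smul, RingHom.id_apply]; module)
  left_inv x := Subtype.ext (cayley_cayley hz (conj_mem_resolvSet hA hz) (x : H))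
  right_inv x := Subtype.ext (cayley_cayley (conj_mem_resolvSet hA hz) hz (x : H))
  norm_map' x := by
    refine (sq_eq_sq₀ (norm_nonneg _) (norm_nonneg _)).1 ?_
    have h := congrArg re (inner_cayley hA hz (x : H) x)
    exact (inner_self_eq_norm_sq (𝕜 := ℂ) _).symm.trans (h.trans (inner_self_eq_norm_sq (𝕜 := ℂ) _))

theorem isClosedSymmetricEqualDefect_restrictKer {τ : GraphSpace A →L[ℂ] 𝔥}
    (hA : IsSelfAdjoint A) (hN : Dense (kerSubspace A τ : Set H)) :
    IsClosedSymmetricEqualDefect (restrictKer A τ) where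
  dense := restrictKer_dense hN
  closed := isClosed_restrictKer hA
  symmetric m n := by
    obtain ⟨f, -, hf, hf'⟩ := exists_incl_eq_restrictKer m
    obtain ⟨g, -, hg, hg'⟩ := exists_incl_eq_restrictKer n
    rw [← hf, ← hf', ← hg, ← hg']
    exact inner_op_left hA f g
  equal_defect := ⟨by
    have e := defectEquiv hA hN (I_mem_resolvSet hA)
    rw [conj_I] at e
    exact e.symm⟩

end Cayley

end SingularPerturbation

namespace SingularPerturbation

open Complex GraphSpace

variable {H : Type*} [NormedAddCommGroup H] [InnerProductSpace ℂ H] [CompleteSpace H]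
variable {𝔥 : Type*} [NormedAddCommGroup 𝔥] [InnerProductSpace ℂ 𝔥] [CompleteSpace 𝔥]
variable {A : H →ₗ.[ℂ] H} {τ : GraphSpace A →L[ℂ] 𝔥} {z w : ℂ}

/-! ### The operators G(z) and G_* -/

theorem inner_G_left (z : ℂ) (ζ : 𝔥) (x : H) :
    inner ℂ (G A τ z ζ) x = inner ℂ ζ (τ (R A (starRingEnd ℂ z) x)) :=
  ContinuousLinearMap.adjoint_inner_left _ _ _

/-- Test G(z)ζ against x = (z̄ - A)f, for which R(z̄)x = f. -/
theorem inner_G_op (hA : IsSelfAdjoint A) (hz : z ∈ resolvSet A) (ζ : 𝔥) (f : GraphSpace A) :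
    inner ℂ (G A τ z ζ) (op A f) = inner ℂ (z • G A τ z ζ) (incl A f) - inner ℂ ζ (τ f) := by
  have h := inner_G_left z ζ (starRingEnd ℂ z • incl A f - op A f) (τ := τ)
  rw [R_smul_sub_op (conj_mem_resolvSet hA hz), inner_sub_right, inner_smul_right] at h
  rw [← h, inner_smul_left]
  ring

theorem G_sub_G (hA : IsSelfAdjoint A) (hz : z ∈ resolvSet A) (hw : w ∈ resolvSet A) (ζ : 𝔥) :
    G A τ w ζ - G A τ z ζ = (z - w) • incl A (R A z (G A τ w ζ)) := by
  refine ext_inner_right ℂ fun x => ?_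
  have h := congrArg τ (R_sub_R (conj_mem_resolvSet hA hz) (conj_mem_resolvSet hA hw) x)
  rw [inner_sub_left, inner_smul_left, inner_incl_R_left hA hz, inner_G_left, inner_G_left,
    inner_G_left, ← inner_sub_right, ← map_sub, h, map_smul, inner_smul_right, map_sub]

theorem mem_defectSpace_restrictKer_iff (hA : IsSelfAdjoint A) (hτ : Function.Surjective τ)
    (hN : Dense (kerSubspace A τ : Set H)) (hz : z ∈ resolvSet A) {x : H} :
    x ∈ defectSpace (restrictKer A τ) z ↔ ∃ ζ, G A τ z ζ = x := by
  rw [mem_defectSpace_iff, mem_graph_adjoint_restrictKer_iff hN]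
  constructor
  · intro h
    have hL : Function.Surjective (τ ∘L R A (starRingEnd ℂ z)) :=
      Function.Surjective.comp (g := τ) hτ (R_surjective (conj_mem_resolvSet hA hz))
    refine exists_adjoint_eq_of_surjective _ hL fun y hy => ?_
    have hop := op_R (conj_mem_resolvSet hA hz) y
    have h' := h (R A (starRingEnd ℂ z) y) hy
    rw [hop, inner_sub_right, inner_smul_left, inner_smul_right] at h'
    linear_combination h'
  · rintro ⟨ζ, rfl⟩ f hf
    rw [inner_G_op hA hz, hf, inner_zero_right, sub_zero]

/-- `G_* - G(z)`, as a bounded operator from `𝔥` to `H₊`. -/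
noncomputable def GstarSubG (A : H →ₗ.[ℂ] H) (τ : GraphSpace A →L[ℂ] 𝔥) (z : ℂ) :
    𝔥 →L[ℂ] GraphSpace A :=
  R A z ∘L ((1 / 2 : ℂ) • ((z - I) • G A τ I + (z + I) • G A τ (-I)))

/-- Average of the identities G(±i) - G(z) = (z ∓ i)R(z)G(±i). -/
theorem incl_GstarSubG (hA : IsSelfAdjoint A) (hz : z ∈ resolvSet A) (ζ : 𝔥) :
    incl A (GstarSubG A τ z ζ) = Gstar A τ ζ - G A τ z ζ := by
  have h1 := G_sub_G hA hz (I_mem_resolvSet hA) ζ (τ := τ)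
  have h2 := G_sub_G hA hz (neg_I_mem_resolvSet hA) ζ (τ := τ)
  change incl A (R A z ((1 / 2 : ℂ) • ((z - I) • G A τ I ζ + (z + I) • G A τ (-I) ζ))) =
    (1 / 2 : ℂ) • (G A τ I ζ + G A τ (-I) ζ) - G A τ z ζ
  rw [sub_neg_eq_add] at h2
  rw [map_smul, map_add, map_smul, map_smul, map_smul, map_add, map_smul, map_smul, ← h1, ← h2]
  module

theorem incl_R_I_G_neg_I (hA : IsSelfAdjoint A) (ζ : 𝔥) :
    incl A (R A I (G A τ (-I) ζ)) = (I / 2) • (G A τ I ζ - G A τ (-I) ζ) := by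
  have h := G_sub_G hA (I_mem_resolvSet hA) (neg_I_mem_resolvSet hA) ζ (τ := τ)
  rw [← neg_sub, h, ← neg_smul, smul_smul]
  convert (one_smul ℂ _).symm using 2
  linear_combination (-1 : ℂ) * I_mul_I

theorem inner_G_I_G_I (hA : IsSelfAdjoint A) (ζ η : 𝔥) :
    inner ℂ (G A τ I ζ) (G A τ I η) = inner ℂ (G A τ (-I) ζ) (G A τ (-I) η) := by
  have h (ζ : 𝔥) : G A τ I ζ = G A τ (-I) ζ -
      (I - starRingEnd ℂ I) • incl A (R A I (G A τ (-I) ζ)) := by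
    rw [conj_I, ← G_sub_G hA (I_mem_resolvSet hA) (neg_I_mem_resolvSet hA), sub_sub_cancel]
  rw [h ζ, h η]
  exact inner_cayley hA (I_mem_resolvSet hA) _ _

theorem inner_Gstar_op (hA : IsSelfAdjoint A) (ζ : 𝔥) (f : GraphSpace A) :
    inner ℂ (Gstar A τ ζ) (op A f) =
      inner ℂ (incl A (R A I (G A τ (-I) ζ))) (incl A f) - inner ℂ ζ (τ f) := by
  have h1 := inner_G_op hA (I_mem_resolvSet hA) ζ f (τ := τ)
  have h2 := inner_G_op hA (neg_I_mem_resolvSet hA) ζ f (τ := τ)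
  change inner ℂ ((1 / 2 : ℂ) • (G A τ I ζ + G A τ (-I) ζ)) (op A f) = _
  rw [incl_R_I_G_neg_I hA]
  simp only [inner_smul_left, inner_add_left, inner_sub_left, map_div₀, conj_I, map_one,
    map_ofNat, map_neg, neg_neg] at h1 h2 ⊢
  rw [h1, h2]
  ring

/-- Symmetry of A_N^* on Ran G_*. Expanding in G(±i), the only obstruction is ⟨G(i)ζ, G(i)η⟩ -
⟨G(-i)ζ, G(-i)η⟩, which vanishes. -/
theorem inner_incl_R_I_Gstar (hA : IsSelfAdjoint A) (ζ η : 𝔥) :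
    inner ℂ (incl A (R A I (G A τ (-I) ζ))) (Gstar A τ η) =
      inner ℂ (Gstar A τ ζ) (incl A (R A I (G A τ (-I) η))) := by
  have h := inner_G_I_G_I hA ζ η (τ := τ)
  rw [incl_R_I_G_neg_I hA, incl_R_I_G_neg_I hA]
  change inner ℂ _ ((1 / 2 : ℂ) • (G A τ I η + G A τ (-I) η)) =
    inner ℂ ((1 / 2 : ℂ) • (G A τ I ζ + G A τ (-I) ζ)) _
  simp only [inner_smul_left, inner_smul_right, inner_add_left, inner_add_right, inner_sub_left,
    inner_sub_right, map_div₀, conj_I, map_one, map_ofNat, h]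
  ring

/-! ### Decomposition of D(A_N^*) -/

theorem mem_graph_adjoint_of_incl_add_Gstar (hA : IsSelfAdjoint A)
    (hN : Dense (kerSubspace A τ : Set H)) (f : GraphSpace A) (ζ : 𝔥) :
    (incl A f + Gstar A τ ζ, op A f + incl A (R A I (G A τ (-I) ζ))) ∈
      (restrictKer A τ).adjoint.graph := by
  rw [mem_graph_adjoint_restrictKer_iff hN]
  intro g hg
  rw [inner_add_left, inner_add_left, inner_Gstar_op hA, hg, inner_zero_right, sub_zero,
    inner_op_left hA]

theorem exists_eq_incl_add_Gstar (hA : IsSelfAdjoint A) (hτ : Function.Surjective τ)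
    (hN : Dense (kerSubspace A τ : Set H)) {x : H} (hx : x ∈ (restrictKer A τ).adjoint.domain) :
    ∃ (f : GraphSpace A) (ζ : 𝔥), x = incl A f + Gstar A τ ζ := by
  have hI := I_mem_resolvSet hA
  obtain ⟨y, hy⟩ : ∃ y, (x, y) ∈ (restrictKer A τ).adjoint.graph :=
    ⟨_, LinearPMap.mem_graph _ ⟨x, hx⟩⟩
  -- Chosen so that (-A + i)g = (-A_N^* + i)x, which puts x - g in K_i.
  let g := R A I (I • x - y)
  have hg : x - incl A g ∈ defectSpace (restrictKer A τ) I := by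
    rw [mem_defectSpace_iff]
    convert sub_mem hy (mem_graph_adjoint_of_incl hA hN g) using 1
    rw [Prod.mk_sub_mk, op_R hI, smul_sub]
    congr 1
    abel
  obtain ⟨ζ, hζ⟩ := (mem_defectSpace_restrictKer_iff hA hτ hN hI).1 hg
  refine ⟨g - GstarSubG A τ I ζ, ζ, ?_⟩
  rw [map_sub, incl_GstarSubG hA hI, hζ]
  abel

/-- A_N^* is single-valued, so Af + R(i)G(-i)ζ = 0 as well. Substituting both relations into
`inner_Gstar_op` and using symmetry of A leaves [ζ, τg] = 0 for every g; take τg = ζ. -/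
theorem eq_zero_of_incl_add_Gstar_eq_zero (hA : IsSelfAdjoint A) (hτ : Function.Surjective τ)
    (hN : Dense (kerSubspace A τ : Set H)) {f : GraphSpace A} {ζ : 𝔥}
    (h : incl A f + Gstar A τ ζ = 0) : f = 0 ∧ ζ = 0 := by
  have hgr := mem_graph_adjoint_of_incl_add_Gstar hA hN f ζ
  rw [h] at hgr
  have h' := LinearPMap.graph_fst_eq_zero_snd _ hgr rfl
  obtain ⟨g, hg⟩ := hτ ζ
  have hζ : ζ = 0 := by
    have e := inner_Gstar_op hA ζ g (τ := τ)
    rw [eq_neg_of_add_eq_zero_right h, eq_neg_of_add_eq_zero_right h', inner_neg_left,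
      inner_neg_left, inner_op_left hA, hg] at e
    refine inner_self_eq_zero (𝕜 := ℂ).1 ?_
    linear_combination e
  rw [hζ, map_zero, add_zero] at h
  exact ⟨incl_injective A (h.trans (map_zero _).symm), hζ⟩

/-- The parametrization `(φ_*, ζ) ↦ φ_* + G_* ζ` of the domain of `A_N^*`. -/
noncomputable def adjointDomainEquiv (hA : IsSelfAdjoint A) (hτ : Function.Surjective τ)
    (hN : Dense (kerSubspace A τ : Set H)) :
    (GraphSpace A × 𝔥) ≃ₗ[ℂ] (restrictKer A τ).adjoint.domain :=
  LinearEquiv.ofBijective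
    (((incl A).coprod (Gstar A τ).toLinearMap).codRestrict (restrictKer A τ).adjoint.domain
      fun p => LinearPMap.mem_domain_of_mem_graph
        (mem_graph_adjoint_of_incl_add_Gstar hA hN p.1 p.2))
    ⟨(injective_iff_map_eq_zero _).2 fun _ hp => Prod.ext_iff.2
      (eq_zero_of_incl_add_Gstar_eq_zero hA hτ hN (congrArg Subtype.val hp)),
    fun x => by
      obtain ⟨f, ζ, h⟩ := exists_eq_incl_add_Gstar hA hτ hN x.2
      exact ⟨(f, ζ), Subtype.ext h.symm⟩⟩

theorem adjointDomainEquiv_symm_eq (hA : IsSelfAdjoint A) (hτ : Function.Surjective τ)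
    (hN : Dense (kerSubspace A τ : Set H)) {φ : (restrictKer A τ).adjoint.domain}
    {f : GraphSpace A} {ζ : 𝔥} (h : (φ : H) = incl A f + Gstar A τ ζ) :
    (adjointDomainEquiv hA hτ hN).symm φ = (f, ζ) :=
  (LinearEquiv.symm_apply_eq _).2 (Subtype.ext h)

theorem adjoint_restrictKer_apply (hA : IsSelfAdjoint A) (hN : Dense (kerSubspace A τ : Set H))
    {φ : (restrictKer A τ).adjoint.domain} {f : GraphSpace A} {ζ : 𝔥}
    (h : (φ : H) = incl A f + Gstar A τ ζ) :
    (restrictKer A τ).adjoint φ = op A f + incl A (R A I (G A τ (-I) ζ)) :=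
  LinearPMap.mem_graph_snd_inj _ (LinearPMap.mem_graph _ φ)
    (mem_graph_adjoint_of_incl_add_Gstar hA hN f ζ) h

/-- The boundary map `γ₁ φ = -τ φ_*`. -/
noncomputable def boundaryMap₁ (hA : IsSelfAdjoint A) (hτ : Function.Surjective τ)
    (hN : Dense (kerSubspace A τ : Set H)) : (restrictKer A τ).adjoint.domain →ₗ[ℂ] 𝔥 :=
  -(τ.toLinearMap ∘ₗ LinearMap.fst ℂ _ _ ∘ₗ (adjointDomainEquiv hA hτ hN).symm.toLinearMap)

/-- The boundary map `γ₂ φ = ζ_φ`. -/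
noncomputable def boundaryMap₂ (hA : IsSelfAdjoint A) (hτ : Function.Surjective τ)
    (hN : Dense (kerSubspace A τ : Set H)) : (restrictKer A τ).adjoint.domain →ₗ[ℂ] 𝔥 :=
  LinearMap.snd ℂ _ _ ∘ₗ (adjointDomainEquiv hA hτ hN).symm.toLinearMap

/-! ### Boundary triple and Weyl function -/

section BoundaryTriple

variable (hA : IsSelfAdjoint A) (hτ : Function.Surjective τ)
  (hN : Dense (kerSubspace A τ : Set H))

theorem boundaryMap₁_eq {φ : (restrictKer A τ).adjoint.domain} {f : GraphSpace A} {ζ : 𝔥}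
    (h : (φ : H) = incl A f + Gstar A τ ζ) : boundaryMap₁ hA hτ hN φ = -τ f := by
  change -τ ((adjointDomainEquiv hA hτ hN).symm φ).1 = _
  rw [adjointDomainEquiv_symm_eq hA hτ hN h]

theorem boundaryMap₂_eq {φ : (restrictKer A τ).adjoint.domain} {f : GraphSpace A} {ζ : 𝔥}
    (h : (φ : H) = incl A f + Gstar A τ ζ) : boundaryMap₂ hA hτ hN φ = ζ := by
  change ((adjointDomainEquiv hA hτ hN).symm φ).2 = _
  rw [adjointDomainEquiv_symm_eq hA hτ hN h]

theorem isBoundaryTriple_restrictKer :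
    IsBoundaryTriple (restrictKer A τ) (boundaryMap₁ hA hτ hN) (boundaryMap₂ hA hτ hN) where
  toIsClosedSymmetricEqualDefect := isClosedSymmetricEqualDefect_restrictKer hA hN
  surjective := by
    rintro ⟨a, b⟩
    obtain ⟨f, hf⟩ := hτ (-a)
    refine ⟨adjointDomainEquiv hA hτ hN (f, b), Prod.ext ?_ ?_⟩
    · exact (boundaryMap₁_eq hA hτ hN (f := f) (ζ := b) rfl).trans (by rw [hf, neg_neg])
    · exact boundaryMap₂_eq hA hτ hN (f := f) (ζ := b) rfl
  green φ ψ := by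
    obtain ⟨f, ζ, hφ⟩ := exists_eq_incl_add_Gstar hA hτ hN φ.2
    obtain ⟨g, η, hψ⟩ := exists_eq_incl_add_Gstar hA hτ hN ψ.2
    rw [boundaryMap₁_eq hA hτ hN hφ, boundaryMap₁_eq hA hτ hN hψ, boundaryMap₂_eq hA hτ hN hφ,
      boundaryMap₂_eq hA hτ hN hψ, adjoint_restrictKer_apply hA hN hφ,
      adjoint_restrictKer_apply hA hN hψ, hφ, hψ]
    -- These two mixed terms produce the boundary form; the pure terms cancel by symmetry.
    have h1 := inner_Gstar_op hA ζ g (τ := τ)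
    have h2 := congrArg (starRingEnd ℂ) (inner_Gstar_op hA η f (τ := τ))
    rw [map_sub, inner_conj_symm, inner_conj_symm, inner_conj_symm] at h2
    simp only [inner_add_left, inner_add_right, inner_neg_left, inner_neg_right,
      inner_op_left hA, inner_incl_R_I_Gstar hA, h1, h2]
    ring

theorem isWeylFunction_restrictKer :
    IsWeylFunction (restrictKer A τ) A (boundaryMap₁ hA hτ hN) (boundaryMap₂ hA hτ hN)
      fun z => τ ∘L GstarSubG A τ z where
  extension_eq := by
    have hle : A ≤ (restrictKer A τ).adjoint := LinearPMap.le_of_le_graph fun ⟨x, y⟩ h => by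
      obtain ⟨f, rfl, rfl⟩ := mem_graph_iff_exists.1 h
      exact mem_graph_adjoint_of_incl hA hN f
    refine LinearPMap.ext ?_ fun x hx hx' => ?_
    · ext x
      constructor
      · rintro ⟨⟨φ, hφ, rfl⟩, -⟩
        obtain ⟨f, ζ, h⟩ := exists_eq_incl_add_Gstar hA hτ hN φ.2
        have h0 : ζ = 0 := (boundaryMap₂_eq hA hτ hN h).symm.trans hφ
        rw [h0, map_zero, add_zero] at h
        exact (congrArg (· ∈ A.domain) h).mpr (incl_mem f)
      · intro hx
        refine ⟨⟨⟨x, hle.1 hx⟩, ?_, rfl⟩, hle.1 hx⟩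
        exact boundaryMap₂_eq hA hτ hN (f := ofDomain A ⟨x, hx⟩) (ζ := 0)
          (by rw [map_zero, add_zero]; rfl)
    · exact (hle.2 (x := ⟨x, hx'⟩) (y := ⟨x, hx.2⟩) rfl).symm
  relation z φ hφ := by
    obtain ⟨ζ, hζ⟩ := (mem_defectSpace_restrictKer_iff hA hτ hN z.2).1 hφ
    have h : (φ : H) = incl A (-GstarSubG A τ z ζ) + Gstar A τ ζ := by
      rw [map_neg, incl_GstarSubG hA z.2, hζ]
      abel
    rw [boundaryMap₁_eq hA hτ hN h, boundaryMap₂_eq hA hτ hN h, map_neg, neg_neg]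
    rfl
  unique Γ' hΓ' := by
    -- γ₂ maps K_z onto 𝔥, since γ₂G(z)ζ = ζ, so the relation determines Γ(z) everywhere.
    ext z ζ
    have hmem := (mem_defectSpace_restrictKer_iff hA hτ hN z.2).2 ⟨ζ, rfl⟩
    have h : G A τ z ζ = incl A (-GstarSubG A τ z ζ) + Gstar A τ ζ := by
      rw [map_neg, incl_GstarSubG hA z.2]
      abel
    have hdom := LinearPMap.mem_domain_of_mem_graph (mem_defectSpace_iff.1 hmem)
    have e := hΓ' z ⟨_, hdom⟩ hmem
    rwa [boundaryMap₁_eq hA hτ hN h, boundaryMap₂_eq hA hτ hN h, map_neg, neg_neg] at e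

end BoundaryTriple

end SingularPerturbation

theorem theorem3p1
    {H : Type*} [NormedAddCommGroup H] [InnerProductSpace ℂ H] [CompleteSpace H]
    {𝔥 : Type*} [NormedAddCommGroup 𝔥] [InnerProductSpace ℂ 𝔥] [CompleteSpace 𝔥]
    (A : H →ₗ.[ℂ] H) (hA : IsSelfAdjoint A)
    (τ : GraphSpace A →L[ℂ] 𝔥) (hτ : Function.Surjective τ)
    (hN : Dense (kerSubspace A τ : Set H)) :
    -- the domain of the adjoint
    ((restrictKer A τ).adjoint.domain : Set H) =
        {φ : H | ∃ (φs : A.domain) (ζ : 𝔥), φ = φs + Gstar A τ ζ} ∧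
    -- the two components are uniquely determined
    (∀ (φs ψs : A.domain) (ζ η : 𝔥),
        (φs : H) + Gstar A τ ζ = ψs + Gstar A τ η → φs = ψs ∧ ζ = η) ∧
    -- the action of the adjoint
    (∀ (φ : (restrictKer A τ).adjoint.domain) (φs : A.domain) (ζ : 𝔥),
        (φ : H) = φs + Gstar A τ ζ →
          (restrictKer A τ).adjoint φ =
            A φs + GraphSpace.incl A (R A Complex.I (G A τ (-Complex.I) ζ))) ∧
    -- the boundary triple and its Weyl function
    ∃ γ₁ γ₂ : (restrictKer A τ).adjoint.domain →ₗ[ℂ] 𝔥,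
      (∀ (φ : (restrictKer A τ).adjoint.domain) (φs : A.domain) (ζ : 𝔥),
        (φ : H) = φs + Gstar A τ ζ →
          γ₁ φ = -τ (GraphSpace.ofDomain A φs) ∧ γ₂ φ = ζ) ∧
      IsBoundaryTriple (restrictKer A τ) γ₁ γ₂ ∧
      ∃ Γ : resolvSet A → (𝔥 →L[ℂ] 𝔥),
        (∀ (z : resolvSet A) (ζ : 𝔥), ∃ h : Gstar A τ ζ - G A τ z ζ ∈ A.domain,
          Γ z ζ = τ (GraphSpace.ofDomain A ⟨Gstar A τ ζ - G A τ z ζ, h⟩)) ∧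
        IsWeylFunction (restrictKer A τ) A γ₁ γ₂ Γ := by
  refine ⟨?_, ?_, ?_, boundaryMap₁ hA hτ hN, boundaryMap₂ hA hτ hN, ?_,
    isBoundaryTriple_restrictKer hA hτ hN, fun z => τ ∘L GstarSubG A τ z, ?_,
    isWeylFunction_restrictKer hA hτ hN⟩
  · ext x
    constructor
    · intro hx
      obtain ⟨f, ζ, h⟩ := exists_eq_incl_add_Gstar hA hτ hN hx
      exact ⟨(GraphSpace.ofDomain A).symm f, ζ, h⟩
    · rintro ⟨φs, ζ, rfl⟩
      exact LinearPMap.mem_domain_of_mem_graph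
        (mem_graph_adjoint_of_incl_add_Gstar hA hN (GraphSpace.ofDomain A φs) ζ)
  · intro φs ψs ζ η h
    have h0 : GraphSpace.incl A (GraphSpace.ofDomain A φs - GraphSpace.ofDomain A ψs) +
        Gstar A τ (ζ - η) = 0 := by
      rw [map_sub, map_sub]
      change ((φs : H) - ψs) + _ = 0
      rw [sub_add_sub_comm, h, sub_self]
    obtain ⟨h1, h2⟩ := eq_zero_of_incl_add_Gstar_eq_zero hA hτ hN h0
    exact ⟨(GraphSpace.ofDomain A).injective (sub_eq_zero.1 h1), sub_eq_zero.1 h2⟩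
  · intro φ φs ζ h
    exact adjoint_restrictKer_apply hA hN (f := GraphSpace.ofDomain A φs) h
  · intro φ φs ζ h
    exact ⟨boundaryMap₁_eq hA hτ hN (f := GraphSpace.ofDomain A φs) h,
      boundaryMap₂_eq hA hτ hN (f := GraphSpace.ofDomain A φs) h⟩
  · intro z ζ
    have h := incl_GstarSubG hA z.2 ζ (τ := τ)
    have hmem : Gstar A τ ζ - G A τ z ζ ∈ A.domain := h ▸ GraphSpace.incl_mem _
    refine ⟨hmem, congrArg τ (GraphSpace.incl_injective A ?_)⟩
    exact h
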